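/- Let $G=(V,E)$ be a finite simple connected graph with a given planar embedding, let $w:E\to\mathbb{R}_{>0}$ be edge weights, let $p\ge 2$, and let $\mathcal{T}_1,\dots,\mathcal{T}_p\subseteq V$ be clusters of terminals. The embedding is given combinatorially, by the cyclic order of the edges around each vertex (a rotation system) of genus $0$; its faces are the closed facial walks. The dual $G^*$ is the multigraph whose vertices are the faces of $G$ and in which every edge $e$ of $G$ gives one dual edge, joining the faces on the two sides of $e$ (a loop if both sides of $e$ lie on the same face). A multi-cluster cut is a set $C\subseteq E$ such that $(V,E\setminus C)$ contains no path between a terminal of $\mathcal{T}_i$ and a terminal of $\mathcal{T}_j$ for any $i\ne j$; it is optimal if its total weight is minimum among all multi-cluster cuts. Let $C$ be an optimal multi-cluster cut such that, for each $i$, exactly one connected component of $(V,E\setminus C)$ contains terminals of $\mathcal{T}_i$. Let $C^*$ be the set of the dual edges of the edges of $C$, and call a vertex of $G^*$ a joint-vertex if its degree in $C^*$ (loops counted twice) is at least $3$. Then the number of joint-vertices is at most $2p-4$. -/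

import Mathlib

/-! ### Combinatorial embeddings, faces and the dual multigraph -/

/-- A rotation system on a simple graph `G`, i.e. a (combinatorial) embedding of `G` in an oriented
surface: around every vertex `v`, the darts (oriented edges) leaving `v` are arranged in one cyclic
order, and `next d` is the dart that follows `d` in the cyclic order around the tail of `d`. -/
structure RotationSystem {V : Type*} (G : SimpleGraph V) where
  /-- The successor of a dart in the cyclic order around its tail. -/
  next : Equiv.Perm G.Dart
  /-- `next` rotates around the tail of the dart. -/
  fst_next : ∀ d : G.Dart, (next d).fst = d.fst
  /-- The darts leaving a vertex form a single cycle of `next`. -/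
  sameCycle_of_fst_eq : ∀ d d' : G.Dart, d.fst = d'.fst → next.SameCycle d d'

namespace RotationSystem

variable {V : Type*} {G : SimpleGraph V}

/-- Facial walks: after traversing the dart `d`, continue with the dart that follows the reversal of
`d` in the cyclic order around the head of `d`. -/
def facePerm (R : RotationSystem G) : Equiv.Perm G.Dart :=
  (Function.Involutive.toPerm SimpleGraph.Dart.symm SimpleGraph.Dart.symm_involutive).trans R.next

/-- The faces of the embedding: the closed facial walks, i.e. the orbits of `facePerm`. -/
def Face (R : RotationSystem G) : Type _ :=
  Quotient (Equiv.Perm.SameCycle.setoid R.facePerm)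

/-- The face lying along a given side of an edge: the dart `d` and its reversal `d.symm` are the two
sides of the edge `d.edge`. -/
def face (R : RotationSystem G) (d : G.Dart) : R.Face :=
  Quotient.mk (Equiv.Perm.SameCycle.setoid R.facePerm) d

/-- The Euler characteristic (vertices, minus edges, plus faces) of the closed surface obtained by
gluing a disc along every facial walk. -/
noncomputable def eulerChar (R : RotationSystem G) : ℤ :=
  (Nat.card V : ℤ) - (G.edgeSet.ncard : ℤ) + (Nat.card R.Face : ℤ)

/-- A rotation system of a connected graph (with at least one edge) is a planar embedding when the
closed connected oriented surface that carries it is the sphere, that is, when this surface has genus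
`0`, where the genus `g` of a surface is given by `eulerChar = 2 - 2 * g`. -/
def IsPlanar (R : RotationSystem G) : Prop :=
  R.eulerChar = 2

/-- The dual multigraph `G*`: its vertices are the faces, and every edge `e` of `G` gives one dual
edge (also named `e`), which joins the faces on the two sides of `e`; it is a loop when both sides of
`e` are on the same face. -/
def dual (R : RotationSystem G) : Graph R.Face (Sym2 V) where
  vertexSet := Set.univ
  IsLink e f g := ∃ d : G.Dart, d.edge = e ∧ R.face d = f ∧ R.face d.symm = g
  isLink_symm := by
    intro e _
    refine ⟨?_⟩
    rintro f g ⟨d, rfl, rfl, rfl⟩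
    exact ⟨d.symm, by simp, rfl, by simp⟩
  eq_or_eq_of_isLink_of_isLink := by
    rintro e f g f' g' ⟨d, hd, rfl, rfl⟩ ⟨d', hd', rfl, rfl⟩
    rcases SimpleGraph.dart_edge_eq_iff d d' |>.1 (hd.trans hd'.symm) with h | h
    · exact Or.inl (by rw [h])
    · exact Or.inr (by rw [h])
  left_mem_of_isLink := by
    intros
    exact Set.mem_univ _

end RotationSystem

/-- The degree of the vertex `x` in the sub-multigraph of `H` with edge set `C`: the number of edges
of `C` incident with `x`, loops at `x` being counted twice. -/
noncomputable def degreeIn {α β : Type*} (H : Graph α β) (C : Set β) (x : α) : ℕ :=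
  {e | e ∈ C ∧ H.Inc e x}.ncard + {e | e ∈ C ∧ H.IsLoopAt e x}.ncard

/-- A joint-vertex of an edge set `C` of `G`: a vertex of the dual graph `G*` (a face of `G`) of
degree at least `3` in the set `C*` of the edges dual to those of `C`. -/
def IsJointVertex {V : Type*} {G : SimpleGraph V} (R : RotationSystem G) (C : Set (Sym2 V))
    (f : R.Face) : Prop :=
  3 ≤ degreeIn R.dual C f

/-! ### Multi-cluster cuts -/

/-- `C` is a multi-cluster cut for the clusters `T 0, …, T (p - 1)` of terminals of `G`: a set of
edges of `G` whose removal leaves no path between terminals of different clusters. -/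
def IsMultiClusterCut {V : Type*} (G : SimpleGraph V) {p : ℕ} (T : Fin p → Set V)
    (C : Finset (Sym2 V)) : Prop :=
  (C : Set (Sym2 V)) ⊆ G.edgeSet ∧
    ∀ i j : Fin p, i ≠ j → ∀ s ∈ T i, ∀ t ∈ T j, ¬ (G.deleteEdges (C : Set (Sym2 V))).Reachable s t

/-- `C` is an optimal (minimum-weight) multi-cluster cut for the edge weights `w`. -/
def IsOptimalMultiClusterCut {V : Type*} (G : SimpleGraph V) (w : Sym2 V → ℝ) {p : ℕ}
    (T : Fin p → Set V) (C : Finset (Sym2 V)) : Prop :=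
  IsMultiClusterCut G T C ∧
    ∀ D : Finset (Sym2 V), IsMultiClusterCut G T D → ∑ e ∈ C, w e ≤ ∑ e ∈ D, w e

/-- The cluster `S` induces exactly one connected component of `(V, E \ C)`: there is exactly one
connected component that contains terminals of `S`. (In particular `S` is nonempty.) -/
def InducesOneComponent {V : Type*} (G : SimpleGraph V) (C : Finset (Sym2 V)) (S : Set V) : Prop :=
  ∃! c : (G.deleteEdges (C : Set (Sym2 V))).ConnectedComponent, ∃ t ∈ S, t ∈ c.supp

/-! Let k be the number of components of G − C, F the set of faces meeting C, and J the number of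
joint-vertices. Three facts give the bound. (1) Optimality: if merging components never joins two
clusters, the edges of C inside the merged parts could be dropped (`exists_terminals`). So each edge
of C joins different components, and each component contains a terminal (`exists_mem_supp`). Since
each cluster meets just one component, k ≤ p. (2) Euler: |C| + 2 ≤ |F| + k (`card_add_two_le`). The
mod 2 cycles of C* have dimension at least |C| − (|F| − 1). On the sphere each is the coboundary of
a function on the components of G − C, taken up to constants, so this dimension is at most k − 1.
(3) A facial walk that meets C crosses it at least twice (`two_le_card_darts`). Counting the sides
of edges of C gives 2|F| + J ≤ 2|C|. Hence J ≤ 2(|C| − |F|) ≤ 2k − 4 ≤ 2p − 4. -/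

/-- A function on the vertices of a graph that does not change along edges is constant on
connected components. -/
theorem SimpleGraph.Reachable.apply_eq {V α : Type*} {H : SimpleGraph V} {q : V → α}
    (hq : ∀ u v, H.Adj u v → q u = q v) {u v : V} (h : H.Reachable u v) : q u = q v := by
  obtain ⟨p⟩ := h
  induction p with
  | nil => rfl
  | cons h _ ih => exact (hq _ _ h).trans ih

/-! ### Facial walks and connectedness of the dual. -/

namespace RotationSystem

variable {V : Type*} {G : SimpleGraph V}

theorem facePerm_apply (R : RotationSystem G) (d : G.Dart) : R.facePerm d = R.next d.symm := rfl

theorem fst_facePerm (R : RotationSystem G) (d : G.Dart) : (R.facePerm d).fst = d.snd :=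
  R.fst_next d.symm

theorem face_facePerm (R : RotationSystem G) (d : G.Dart) : R.face (R.facePerm d) = R.face d :=
  Quotient.sound (s := Equiv.Perm.SameCycle.setoid R.facePerm)
    (Equiv.Perm.sameCycle_apply_left.2 (Equiv.Perm.SameCycle.refl _ _))

theorem face_surjective (R : RotationSystem G) : Function.Surjective R.face :=
  Quotient.mk_surjective

instance [Finite V] : Finite G.Dart :=
  Finite.of_injective _ SimpleGraph.Dart.toProd_injective

instance [Finite V] (R : RotationSystem G) : Finite R.Face :=
  Finite.of_surjective _ R.face_surjective

/-- The dual of a connected graph is connected: a function on the faces that takes the same value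
on the two sides of every edge is constant. -/
theorem eq_of_face_symm_eq {α : Type*} (R : RotationSystem G) (hG : G.Connected) {g : R.Face → α}
    (hg : ∀ d : G.Dart, g (R.face d) = g (R.face d.symm)) (f f' : R.Face) : g f = g f' := by
  -- `next d` follows `d.symm` on its facial walk, so rotating about a vertex crosses one edge at a
  -- time and `g` is constant around each vertex.
  have hnext : ∀ d : G.Dart, g (R.face (R.next d)) = g (R.face d) := by
    intro d
    have := R.face_facePerm d.symm
    rw [facePerm_apply, SimpleGraph.Dart.symm_symm] at this
    rw [this, ← hg]
  have hzpow : ∀ (n : ℤ) (d : G.Dart), g (R.face ((R.next ^ n) d)) = g (R.face d) := by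
    intro n
    induction n with
    | zero => simp
    | succ n ih =>
      intro d
      rw [zpow_add_one, Equiv.Perm.mul_apply, ih, hnext]
    | pred n ih =>
      intro d
      rw [zpow_sub_one, Equiv.Perm.mul_apply, ih]
      have := hnext (R.next⁻¹ d)
      rw [← Equiv.Perm.mul_apply, mul_inv_cancel, Equiv.Perm.one_apply] at this
      exact this.symm
  have hfst : ∀ d d' : G.Dart, d.fst = d'.fst → g (R.face d) = g (R.face d') := by
    intro d d' h
    obtain ⟨n, rfl⟩ := R.sameCycle_of_fst_eq d d' h
    exact (hzpow n d).symm
  obtain ⟨d₀, rfl⟩ := R.face_surjective f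
  obtain ⟨d₁, rfl⟩ := R.face_surjective f'
  have key : ∀ v, G.Reachable d₀.fst v → ∀ d : G.Dart, d.fst = v →
      g (R.face d₀) = g (R.face d) := by
    rintro v ⟨p⟩
    generalize hu : d₀.fst = u at p
    induction p generalizing d₀ with
    | nil => exact fun d hd => hfst _ _ (hu.trans hd.symm)
    | @cons u v w h p ih =>
      intro d hd
      have e : g (R.face d₀) = g (R.face (⟨(u, v), h⟩ : G.Dart)) := hfst _ _ hu
      rw [e, hg]
      exact ih _ rfl d hd
  exact key _ (hG.preconnected _ _) d₁ rfl

/-- The edge of a dart, as an element of the edge set. -/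
def dartEdge (d : G.Dart) : G.edgeSet := ⟨d.edge, d.edge_mem⟩

theorem dartEdge_surjective : Function.Surjective (dartEdge (G := G)) := by
  rintro ⟨e, he⟩
  induction e with
  | _ u v => exact ⟨⟨(u, v), he⟩, rfl⟩

/-! ### Homology modulo 2 of the embedding. -/

section Homology

variable [Fintype V] (R : RotationSystem G)

noncomputable instance : Fintype G.edgeSet := Fintype.ofFinite _

noncomputable instance : Fintype G.Dart := Fintype.ofFinite _

noncomputable instance : Fintype R.Face := Fintype.ofFinite _

open scoped Classical in
theorem sum_filter_dartEdge {M : Type*} [AddCommMonoid M] (k : G.Dart → M) (d : G.Dart) :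
    ∑ d' with dartEdge d' = dartEdge d, k d' = k d + k d.symm := by
  have : (Finset.univ.filter fun d' : G.Dart => dartEdge d' = dartEdge d) = {d, d.symm} := by
    ext d'
    simp [dartEdge, Subtype.ext_iff, SimpleGraph.dart_edge_eq_iff]
  rw [this, Finset.sum_pair d.symm_ne.symm]

open scoped Classical in
/-- The incidence matrix modulo `2` between faces and edges. -/
noncomputable def faceMatrix : Matrix R.Face G.edgeSet (ZMod 2) :=
  fun f e => ∑ d : G.Dart, if R.face d = f ∧ dartEdge d = e then 1 else 0

open scoped Classical in
theorem faceMatrix_mulVec (φ : G.edgeSet → ZMod 2) (f : R.Face) :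
    (R.faceMatrix.mulVec φ) f = ∑ d with R.face d = f, φ (dartEdge d) := by
  simp only [Matrix.mulVec, dotProduct, faceMatrix, Finset.sum_mul, ite_mul, one_mul, zero_mul]
  rw [Finset.sum_comm, Finset.sum_filter]
  refine Finset.sum_congr rfl fun d _ => ?_
  by_cases h : R.face d = f <;> simp [h]

open scoped Classical in
theorem faceMatrix_transpose_mulVec (g : R.Face → ZMod 2) (d : G.Dart) :
    (R.faceMatrix.transpose.mulVec g) (dartEdge d) = g (R.face d) + g (R.face d.symm) := by
  rw [← sum_filter_dartEdge (fun d => g (R.face d))]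
  simp only [Matrix.mulVec, dotProduct, faceMatrix, Finset.sum_mul, ite_mul, one_mul, zero_mul,
    Matrix.transpose_apply]
  rw [Finset.sum_comm, Finset.sum_filter]
  refine Finset.sum_congr rfl fun d' _ => ?_
  by_cases h : dartEdge d' = dartEdge d <;> simp [h]

open scoped Classical in
/-- The coboundary modulo `2` of a function on the vertices. -/
noncomputable def coboundary (G : SimpleGraph V) : (V → ZMod 2) →ₗ[ZMod 2] (G.edgeSet → ZMod 2) where
  toFun h e := ∑ d : G.Dart with dartEdge d = e, h d.fst
  map_add' h h' := by ext e; simp [Finset.sum_add_distrib]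
  map_smul' c h := by ext e; simp [Finset.mul_sum]

theorem coboundary_dartEdge (h : V → ZMod 2) (d : G.Dart) :
    coboundary G h (dartEdge d) = h d.fst + h d.snd :=
  sum_filter_dartEdge (fun d => h d.fst) d

theorem finrank_le_one_of_const {ι : Type*} [Fintype ι] (S : Submodule (ZMod 2) (ι → ZMod 2))
    (hS : ∀ g ∈ S, ∀ i j, g i = g j) : Module.finrank (ZMod 2) S ≤ 1 := by
  refine finrank_le_one_iff.2 ?_
  by_cases h : ∃ v ∈ S, v ≠ 0
  · obtain ⟨v, hv, hv0⟩ := h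
    refine ⟨⟨v, hv⟩, fun w => ⟨?_, ?_⟩⟩
    · exact if (w : ι → ZMod 2) = 0 then 0 else 1
    · obtain ⟨i, hi⟩ := Function.ne_iff.1 hv0
      have h1 : ∀ x : ZMod 2, x ≠ 0 → x = 1 := by decide
      have hv1 : ∀ j, v j = 1 := fun j => (hS v hv j i).trans (h1 _ hi)
      ext j
      split_ifs with hw
      · simp [hw]
      · obtain ⟨k, hk⟩ := Function.ne_iff.1 hw
        simp [hv1, hS w w.2 j k, h1 _ hk]
  · push Not at h
    exact ⟨0, fun w => ⟨0, by ext1; simp [h w w.2]⟩⟩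

theorem finrank_ker_coboundary_le (hG : G.Connected) :
    Module.finrank (ZMod 2) (LinearMap.ker (coboundary G)) ≤ 1 := by
  refine finrank_le_one_of_const _ fun h hh u v =>
    (hG.preconnected u v).apply_eq fun a b hab => ?_
  have := coboundary_dartEdge h (⟨(a, b), hab⟩ : G.Dart)
  rw [LinearMap.mem_ker.1 hh] at this
  exact CharTwo.add_eq_zero.1 this.symm

/-- The left kernel of the matrix consists of the functions that agree on both sides of every edge;
the dual being connected, these are constants. -/
theorem card_face_le_rank_add_one (hG : G.Connected) :
    Fintype.card R.Face ≤ R.faceMatrix.rank + 1 := by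
  rw [← Matrix.rank_transpose, Matrix.rank]
  have h := LinearMap.finrank_range_add_finrank_ker R.faceMatrix.transpose.mulVecLin
  rw [Module.finrank_fintype_fun_eq_card] at h
  have : Module.finrank (ZMod 2) (LinearMap.ker R.faceMatrix.transpose.mulVecLin) ≤ 1 := by
    refine finrank_le_one_of_const _ fun g hg => R.eq_of_face_symm_eq hG fun d => ?_
    have := R.faceMatrix_transpose_mulVec g d
    rw [← Matrix.mulVecLin_apply, LinearMap.mem_ker.1 hg] at this
    exact CharTwo.add_eq_zero.1 this.symm
  omega

/-- The head of each dart of a facial walk is the tail of the next one, so around a face every value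
is summed twice. -/
theorem faceMatrix_mulVec_coboundary (h : V → ZMod 2) :
    R.faceMatrix.mulVec (coboundary G h) = 0 := by
  classical
  ext f
  rw [faceMatrix_mulVec]
  simp only [coboundary_dartEdge, Finset.sum_add_distrib, Pi.zero_apply]
  refine CharTwo.add_eq_zero.2 (Eq.symm ?_)
  refine Finset.sum_equiv R.facePerm (fun d => ?_) fun d _ => ?_
  · simp [face_facePerm]
  · rw [fst_facePerm]

/-- On the sphere every cocycle modulo `2` is a coboundary. -/
theorem ker_faceMatrix_eq_range_coboundary (hG : G.Connected) (hR : R.IsPlanar) :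
    LinearMap.range (coboundary G) = LinearMap.ker R.faceMatrix.mulVecLin := by
  refine Submodule.eq_of_le_of_finrank_le ?_ ?_
  · rintro _ ⟨h, rfl⟩
    exact R.faceMatrix_mulVec_coboundary h
  -- The range has dimension at least |V| − 1, the kernel at most |E| − |Faces| + 1; genus 0 makes
  -- these two bounds equal.
  · have h1 := LinearMap.finrank_range_add_finrank_ker (coboundary G)
    have h2 := LinearMap.finrank_range_add_finrank_ker R.faceMatrix.mulVecLin
    have h3 := finrank_ker_coboundary_le hG
    have h4 := R.card_face_le_rank_add_one hG
    rw [Matrix.rank] at h4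
    rw [Module.finrank_fintype_fun_eq_card] at h1 h2
    have h5 : R.eulerChar = 2 := hR
    rw [eulerChar, Nat.card_eq_fintype_card, Nat.card_eq_fintype_card, ← Nat.card_coe_set_eq,
      Nat.card_eq_fintype_card] at h5
    omega

/-! ### Euler's inequality for the dual of a cut. -/

open scoped Classical in
/-- Euler's inequality for the subgraph of the dual spanned by a nonempty edge set `C`. -/
theorem card_add_two_le (hG : G.Connected) (hR : R.IsPlanar) (C : Finset (Sym2 V))
    (hCG : (C : Set (Sym2 V)) ⊆ G.edgeSet) (hC : C.Nonempty) :
    C.card + 2 ≤ (Finset.univ.filter fun f : R.Face => ∃ d, R.face d = f ∧ d.edge ∈ C).card +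
      Nat.card (G.deleteEdges (C : Set (Sym2 V))).ConnectedComponent := by
  set F := Finset.univ.filter fun f : R.Face => ∃ d, R.face d = f ∧ d.edge ∈ C with hF
  set H := G.deleteEdges (C : Set (Sym2 V)) with hH
  obtain ⟨d₀, hd₀⟩ : ∃ d₀ : G.Dart, d₀.edge ∈ C := by
    obtain ⟨e, he⟩ := hC
    obtain ⟨d, hd⟩ := dartEdge_surjective ⟨e, hCG he⟩
    exact ⟨d, by rw [show d.edge = e from congrArg Subtype.val hd]; exact he⟩
  have hf₀ : R.face d₀ ∈ F := by simp only [hF, Finset.mem_filter_univ]; exact ⟨d₀, rfl, hd₀⟩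
  let ext0 : (C → ZMod 2) →ₗ[ZMod 2] (G.edgeSet → ZMod 2) :=
    { toFun := fun φ e => if h : (e : Sym2 V) ∈ C then φ ⟨e, h⟩ else 0
      map_add' := by intro φ ψ; ext e; by_cases h : (e : Sym2 V) ∈ C <;> simp [h]
      map_smul' := by intro c φ; ext e; by_cases h : (e : Sym2 V) ∈ C <;> simp [h] }
  have hext_pos : ∀ φ (e : G.edgeSet) (h : (e : Sym2 V) ∈ C), ext0 φ e = φ ⟨e, h⟩ :=
    fun φ e h => dif_pos h
  have hext_neg : ∀ φ (e : G.edgeSet), (e : Sym2 V) ∉ C → ext0 φ e = 0 := fun φ e h => dif_neg h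
  have hinj : Function.Injective ext0 := by
    intro φ ψ h
    ext ⟨e, he⟩
    have := congrFun h ⟨e, hCG he⟩
    rwa [hext_pos _ _ he, hext_pos _ _ he] at this
  -- One face of `F` is left out of the target: the sums over all faces add up to 0, so the
  -- condition at that face follows from the others. This gains one dimension.
  let ψ : (C → ZMod 2) →ₗ[ZMod 2] (F.erase (R.face d₀) → ZMod 2) :=
    LinearMap.funLeft (ZMod 2) (ZMod 2) Subtype.val ∘ₗ R.faceMatrix.mulVecLin ∘ₗ ext0
  have hψ : ∀ φ, ψ φ = 0 → R.faceMatrix.mulVec (ext0 φ) = 0 := by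
    intro φ hφ
    have hne : ∀ f, f ≠ R.face d₀ → R.faceMatrix.mulVec (ext0 φ) f = 0 := by
      intro f hf
      by_cases hfF : f ∈ F
      · exact congrFun hφ ⟨f, Finset.mem_erase.2 ⟨hf, hfF⟩⟩
      · rw [faceMatrix_mulVec]
        refine Finset.sum_eq_zero fun d hd => hext_neg _ _ fun hdC => hfF ?_
        simp only [hF, Finset.mem_filter_univ]
        exact ⟨d, by simpa using hd, hdC⟩
    have hsum : ∑ f, R.faceMatrix.mulVec (ext0 φ) f = 0 := by
      have h1 := Matrix.dotProduct_mulVec (fun _ => (1 : ZMod 2)) R.faceMatrix (ext0 φ)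
      have h2 : Matrix.vecMul (fun _ => (1 : ZMod 2)) R.faceMatrix = 0 := by
        rw [← Matrix.mulVec_transpose]
        ext e
        obtain ⟨d, rfl⟩ := dartEdge_surjective e
        rw [faceMatrix_transpose_mulVec]
        exact CharTwo.add_self_eq_zero _
      rw [h2, zero_dotProduct] at h1
      simpa [dotProduct] using h1
    ext f
    by_cases hf : f = R.face d₀
    · rw [Finset.sum_eq_single (R.face d₀) (fun f _ hf => hne f hf) (by simp)] at hsum
      rw [hf, hsum]; rfl
    · exact hne f hf
  -- Constants lie in the kernel of `K`, so its range has dimension at most k − 1.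
  let K : (H.ConnectedComponent → ZMod 2) →ₗ[ZMod 2] (G.edgeSet → ZMod 2) :=
    coboundary G ∘ₗ LinearMap.funLeft (ZMod 2) (ZMod 2) H.connectedComponentMk
  have hker : (LinearMap.ker ψ).map ext0 ≤ LinearMap.range K := by
    rintro _ ⟨φ, hφ, rfl⟩
    have : ext0 φ ∈ LinearMap.range (coboundary G) := by
      rw [R.ker_faceMatrix_eq_range_coboundary hG hR]
      exact hψ φ hφ
    obtain ⟨h, hh⟩ := this
    -- The cocycle vanishes off `C`, so its potential `h` is unchanged along edges of `H` and
    -- descends to components.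
    have hconst : ∀ u v, H.Reachable u v → h u = h v := by
      intro u v huv
      refine huv.apply_eq fun a b hab => ?_
      rw [hH, SimpleGraph.deleteEdges_adj] at hab
      have := coboundary_dartEdge h (⟨(a, b), hab.1⟩ : G.Dart)
      rw [hh, hext_neg _ _ hab.2] at this
      exact CharTwo.add_eq_zero.1 this.symm
    refine ⟨fun c => c.lift h (fun u v p _ => hconst u v ⟨p⟩), ?_⟩
    rw [← hh]
    rfl
  have hKone : 1 ≤ Module.finrank (ZMod 2) (LinearMap.ker K) := by
    refine Nat.one_le_iff_ne_zero.2 fun h0 => ?_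
    rw [Submodule.finrank_eq_zero] at h0
    have hmem : (fun _ => 1 : H.ConnectedComponent → ZMod 2) ∈ LinearMap.ker K := by
      rw [LinearMap.mem_ker]
      ext e
      obtain ⟨d, rfl⟩ := dartEdge_surjective e
      exact (coboundary_dartEdge _ d).trans (CharTwo.add_self_eq_zero _)
    rw [h0, Submodule.mem_bot] at hmem
    exact one_ne_zero (congrFun hmem (H.connectedComponentMk d₀.fst))
  have h1 := LinearMap.finrank_range_add_finrank_ker ψ
  have h2 := Submodule.finrank_le (LinearMap.range ψ)
  have h3 := LinearMap.finrank_range_add_finrank_ker K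
  have h4 := Submodule.finrank_mono hker
  rw [← (Submodule.equivMapOfInjective ext0 hinj (LinearMap.ker ψ)).finrank_eq] at h4
  rw [Module.finrank_fintype_fun_eq_card, Fintype.card_coe] at h1 h2
  rw [Module.finrank_fintype_fun_eq_card, ← Nat.card_eq_fintype_card] at h3
  rw [Finset.card_erase_of_mem hf₀] at h2
  have h5 : 0 < F.card := Finset.card_pos.2 ⟨_, hf₀⟩
  omega

/-! ### Counting sides of cut edges, face by face. -/

open scoped Classical in
/-- The degree of a face in the dual of `C` is at most the number of darts of `C` on its facial
walk. -/
theorem degreeIn_dual_le (C : Finset (Sym2 V)) (f : R.Face) :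
    degreeIn R.dual (C : Set (Sym2 V)) f ≤
      (Finset.univ.filter fun d : G.Dart => d.edge ∈ C ∧ R.face d = f).card := by
  set D := Finset.univ.filter fun d : G.Dart => d.edge ∈ C ∧ R.face d = f with hD
  have hinc : ∀ e, e ∈ (C : Set (Sym2 V)) ∧ R.dual.Inc e f → ∃ d ∈ D, d.edge = e := by
    rintro _ ⟨he, g, d, rfl, hd, -⟩
    exact ⟨d, by simpa [hD] using ⟨he, hd⟩, rfl⟩
  have hloop : ∀ d : G.Dart, R.dual.IsLoopAt d.edge f → R.face d.symm = f := by
    rintro d ⟨d', hdd, h1, h2⟩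
    rcases (SimpleGraph.dart_edge_eq_iff d' d).1 hdd with rfl | rfl
    · exact h2
    · exact h1
  have : Nonempty G.Dart := (R.face_surjective f).nonempty
  -- Each incident edge is charged to one of its darts on `f`; a loop is charged to the reversed
  -- dart as well, which matches its double count in the degree.
  choose! s hsD hse using hinc
  set A := {e | e ∈ (C : Set (Sym2 V)) ∧ R.dual.Inc e f}
  set B := {e | e ∈ (C : Set (Sym2 V)) ∧ R.dual.IsLoopAt e f}
  have hBA : B ⊆ A := fun e he => ⟨he.1, f, he.2⟩
  have hsinj : Set.InjOn s A := fun a ha b hb h => by rw [← hse a ha, ← hse b hb, h]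
  have hA : (s '' A).ncard = A.ncard := hsinj.ncard_image
  have hB : ((fun e => (s e).symm) '' B).ncard = B.ncard := by
    refine Set.InjOn.ncard_image fun a ha b hb h => ?_
    exact hsinj (hBA ha) (hBA hb) (SimpleGraph.Dart.symm_involutive.injective h)
  have hdisj : Disjoint (s '' A) ((fun e => (s e).symm) '' B) := by
    rw [Set.disjoint_left]
    rintro _ ⟨a, ha, rfl⟩ ⟨b, hb, hab⟩
    have : b = a := by
      rw [← hse a ha, ← hse b (hBA hb), ← hab]
      exact (SimpleGraph.Dart.edge_symm _).symm
    subst this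
    exact (s b).symm_ne hab
  have hsub : s '' A ∪ (fun e => (s e).symm) '' B ⊆ (D : Set G.Dart) := by
    rintro _ (⟨a, ha, rfl⟩ | ⟨b, hb, rfl⟩)
    · exact hsD a ha
    · have h1 := hsD b (hBA hb)
      have h2 := hse b (hBA hb)
      simp only [hD, Finset.coe_filter_univ, Set.mem_ofPred_eq, SimpleGraph.Dart.edge_symm, h2]
      exact ⟨hb.1, hloop _ (by rw [h2]; exact hb.2)⟩
  have := Set.ncard_le_ncard hsub (Finset.finite_toSet D)
  rw [Set.ncard_union_eq hdisj, hA, hB, Set.ncard_coe_finset] at this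
  exact this

open scoped Classical in
/-- If the endpoints of every edge of `C` lie in different components after the deletion of `C`,
then no facial walk crosses `C` exactly once. -/
theorem two_le_card_darts (C : Finset (Sym2 V))
    (hsep : ∀ d : G.Dart, d.edge ∈ C →
      ¬ (G.deleteEdges (C : Set (Sym2 V))).Reachable d.fst d.snd)
    (d : G.Dart) (hd : d.edge ∈ C) :
    2 ≤ (Finset.univ.filter fun d' : G.Dart => d'.edge ∈ C ∧ R.face d' = R.face d).card := by
  by_contra hlt
  have huniq : ∀ d' : G.Dart, d'.edge ∈ C → R.face d' = R.face d → d' = d := by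
    intro d' h1 h2
    refine Finset.card_le_one.1 (Nat.le_of_lt_succ (not_le.1 hlt)) d' ?_ d ?_ <;>
      simp [h1, h2, hd]
  set H := G.deleteEdges (C : Set (Sym2 V)) with hH
  obtain ⟨n, hn0, hn⟩ : ∃ n : ℕ, 0 < n ∧ (R.facePerm ^ n) d = d :=
    ⟨orderOf R.facePerm, orderOf_pos _, by simp [pow_orderOf_eq_one]⟩
  have hface : ∀ k : ℕ, R.face ((R.facePerm ^ k) d) = R.face d := by
    intro k
    induction k with
    | zero => rfl
    | succ k ih => rw [pow_succ', Equiv.Perm.mul_apply, face_facePerm, ih]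
  -- Follow the facial walk from the head of `d`. Darts outside `C` stay in one component, and the
  -- first dart in `C` can only be `d` itself, whose tail is thereby connected to its head.
  have key : ∀ k : ℕ, H.Reachable ((R.facePerm ^ (k + 1)) d).fst d.snd ∨
      H.Reachable d.fst d.snd := by
    intro k
    induction k with
    | zero => left; rw [zero_add, pow_one, fst_facePerm]
    | succ k ih =>
      rcases ih with ih | ih
      · by_cases hk : ((R.facePerm ^ (k + 1)) d).edge ∈ C
        · right
          rwa [huniq _ hk (hface _)] at ih
        · left
          rw [pow_succ', Equiv.Perm.mul_apply, fst_facePerm]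
          refine SimpleGraph.Reachable.trans (SimpleGraph.Adj.reachable ?_) ih
          rw [hH, SimpleGraph.deleteEdges_adj]
          refine ⟨((R.facePerm ^ (k + 1)) d).adj.symm, fun hmem => hk ?_⟩
          rw [Sym2.eq_swap] at hmem
          exact hmem
      · exact Or.inr ih
  rcases key (n - 1) with h | h
  · rw [Nat.sub_add_cancel hn0, hn] at h
    exact hsep d hd h
  · exact hsep d hd h

open scoped Classical in
theorem card_darts_edge_mem (C : Finset (Sym2 V)) (hCG : (C : Set (Sym2 V)) ⊆ G.edgeSet) :
    (Finset.univ.filter fun d : G.Dart => d.edge ∈ C).card = 2 * C.card := by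
  rw [Finset.card_eq_sum_card_fiberwise (f := fun d : G.Dart => d.edge) (t := C)
    (fun d hd => by simpa using hd), Finset.sum_const_nat (m := 2), mul_comm]
  intro e he
  obtain ⟨d, hd⟩ := dartEdge_surjective ⟨e, hCG he⟩
  obtain rfl : d.edge = e := congrArg Subtype.val hd
  have : (Finset.univ.filter fun d' : G.Dart => d'.edge ∈ C).filter (fun d' => d'.edge = d.edge) =
      {d, d.symm} := by
    ext d'
    simp only [Finset.mem_filter, Finset.mem_univ, true_and, Finset.mem_insert,
      Finset.mem_singleton, ← SimpleGraph.dart_edge_eq_iff]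
    exact ⟨fun h => h.2, fun h => ⟨h ▸ he, h⟩⟩
  rw [this, Finset.card_pair d.symm_ne.symm]

/-- A cut all of whose edges separate different components has few joint-vertices, in terms of the
number of components. -/
theorem ncard_jointVertex_add_four_le (hG : G.Connected) (hR : R.IsPlanar) (C : Finset (Sym2 V))
    (hCG : (C : Set (Sym2 V)) ⊆ G.edgeSet) (hC : C.Nonempty)
    (hsep : ∀ d : G.Dart, d.edge ∈ C →
      ¬ (G.deleteEdges (C : Set (Sym2 V))).Reachable d.fst d.snd) :
    {f : R.Face | IsJointVertex R (C : Set (Sym2 V)) f}.ncard + 4 ≤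
      2 * Nat.card (G.deleteEdges (C : Set (Sym2 V))).ConnectedComponent := by
  classical
  have h1 := R.card_add_two_le hG hR C hCG hC
  set F := Finset.univ.filter fun f : R.Face => ∃ d, R.face d = f ∧ d.edge ∈ C with hF
  set n : R.Face → ℕ := fun f =>
    (Finset.univ.filter fun d : G.Dart => d.edge ∈ C ∧ R.face d = f).card with hn
  have h2 : 2 * C.card = ∑ f ∈ F, n f := by
    rw [← card_darts_edge_mem C hCG,
      Finset.card_eq_sum_card_fiberwise (f := R.face) (t := F)]
    · simp only [hn, Finset.filter_filter]
    · intro d hd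
      simp only [hF, Finset.coe_filter_univ, Set.mem_ofPred_eq] at hd ⊢
      exact ⟨d, rfl, hd⟩
  -- Summed over `F`, this reads 2|F| + J ≤ 2|C|, with J bounded by the number of faces having at
  -- least three sides in `C`.
  have h3 : ∀ f ∈ F, 2 + (if 3 ≤ n f then 1 else 0) ≤ n f := by
    intro f hf
    simp only [hF, Finset.mem_filter_univ] at hf
    obtain ⟨d, rfl, hd⟩ := hf
    have : 2 ≤ n (R.face d) := R.two_le_card_darts C hsep d hd
    split_ifs <;> omega
  have h4 := Finset.sum_le_sum h3
  rw [Finset.sum_add_distrib, Finset.sum_const, smul_eq_mul, ← Finset.card_filter] at h4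
  have h5 : {f : R.Face | IsJointVertex R (C : Set (Sym2 V)) f}.ncard ≤
      (F.filter fun f => 3 ≤ n f).card := by
    rw [← Set.ncard_coe_finset]
    refine Set.ncard_le_ncard (fun f hf => ?_) (Finset.finite_toSet _)
    have h3n : 3 ≤ n f := le_trans hf (R.degreeIn_dual_le C f)
    obtain ⟨d, hd⟩ := Finset.card_pos.1 (show 0 < n f by omega)
    simp only [Finset.mem_filter_univ] at hd
    simp only [hF, Finset.coe_filter, Finset.mem_filter_univ, Set.mem_ofPred_eq]
    exact ⟨⟨d, hd.2, hd.1⟩, h3n⟩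
  omega

end Homology

end RotationSystem

/-! ### Consequences of optimality. -/

/-- An edge of an optimal cut cannot be spared: every labelling of the vertices that is constant on
the components left by the cut and that identifies the ends of the edge identifies two terminals of
different clusters. -/
theorem IsOptimalMultiClusterCut.exists_terminals {V α : Type*} {G : SimpleGraph V} {w : Sym2 V → ℝ}
    (hw : ∀ e ∈ G.edgeSet, 0 < w e) {p : ℕ} {T : Fin p → Set V} {C : Finset (Sym2 V)}
    (hC : IsOptimalMultiClusterCut G w T C) {q : V → α}
    (hq : ∀ u v, (G.deleteEdges (C : Set (Sym2 V))).Adj u v → q u = q v)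
    {u v : V} (huv : s(u, v) ∈ C) (hquv : q u = q v) :
    ∃ i j : Fin p, i ≠ j ∧ ∃ s ∈ T i, ∃ t ∈ T j, q s = q t := by
  classical
  by_contra! hcon
  -- `q` is constant on the components left by the smaller set, so a path between different clusters
  -- would give terminals with equal label. Positive weight then makes the smaller cut strictly
  -- cheaper.
  have hD : IsMultiClusterCut G T (C.erase s(u, v)) := by
    refine ⟨fun e he => hC.1.1 (Finset.mem_of_mem_erase he), fun i j hij s hs t ht hst => ?_⟩
    refine hcon i j hij s hs t ht (hst.apply_eq fun a b hab => ?_)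
    rw [SimpleGraph.deleteEdges_adj] at hab
    by_cases he : s(a, b) = s(u, v)
    · rcases Sym2.eq_iff.1 he with ⟨rfl, rfl⟩ | ⟨rfl, rfl⟩
      · exact hquv
      · exact hquv.symm
    · refine hq a b ?_
      rw [SimpleGraph.deleteEdges_adj]
      exact ⟨hab.1, fun h => hab.2 (Finset.mem_erase.2 ⟨he, h⟩)⟩
  have h1 := hC.2 _ hD
  have h2 := Finset.add_sum_erase C w huv
  have h3 := hw _ (hC.1.1 huv)
  linarith

/-- Every component left by an optimal cut contains a terminal. -/
theorem IsOptimalMultiClusterCut.exists_mem_supp {V : Type*} {G : SimpleGraph V} (hG : G.Connected)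
    {w : Sym2 V → ℝ} (hw : ∀ e ∈ G.edgeSet, 0 < w e) {p : ℕ} {T : Fin p → Set V}
    {C : Finset (Sym2 V)} (hC : IsOptimalMultiClusterCut G w T C) (hT : ∃ i, (T i).Nonempty)
    (c : (G.deleteEdges (C : Set (Sym2 V))).ConnectedComponent) : ∃ i, ∃ t ∈ T i, t ∈ c.supp := by
  classical
  by_contra! hcon
  obtain ⟨i₀, t₀, ht₀⟩ := hT
  obtain ⟨u₀, hu₀⟩ := c.nonempty_supp
  obtain ⟨u, v, huv, hu, hv⟩ : ∃ u v, G.Adj u v ∧ u ∈ c.supp ∧ v ∉ c.supp := by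
    by_contra! hclosed
    have : ∀ a b, G.Adj a b → (a ∈ c.supp) = (b ∈ c.supp) := fun a b hab =>
      propext ⟨hclosed a b hab, hclosed b a hab.symm⟩
    exact hcon i₀ t₀ ht₀ (((hG.preconnected u₀ t₀).apply_eq this).mp hu₀)
  have huvC : s(u, v) ∈ C := by
    by_contra hn
    have hadj : (G.deleteEdges (C : Set (Sym2 V))).Adj u v := by
      rw [SimpleGraph.deleteEdges_adj]
      exact ⟨huv, hn⟩
    exact hv ((c.mem_supp_congr_adj hadj).1 hu)
  -- The terminal-free component `c` is merged into its neighbour containing `v`. This identifies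
  -- `u` with `v` but leaves the label of every terminal unchanged.
  set q : V → (G.deleteEdges (C : Set (Sym2 V))).ConnectedComponent := fun x =>
    if x ∈ c.supp then SimpleGraph.connectedComponentMk _ v else SimpleGraph.connectedComponentMk _ x with hqdef
  obtain ⟨i, j, hij, s, hs, t, ht, hst⟩ := hC.exists_terminals (q := q) hw (fun a b hab => by
    have h1 := SimpleGraph.ConnectedComponent.connectedComponentMk_eq_of_adj hab
    have h2 := c.mem_supp_congr_adj hab
    simp only [hqdef, h2, h1]) huvC (by simp only [hqdef, if_pos hu, if_neg hv])
  simp only [hqdef, hcon i s hs, hcon j t ht, if_false] at hst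
  exact hC.1.2 i j hij s hs t ht (SimpleGraph.ConnectedComponent.exact hst)

theorem mainTheorem5 {V : Type*} [Finite V] (G : SimpleGraph V) (hG : G.Connected)
    (R : RotationSystem G) (hR : R.IsPlanar)
    (w : Sym2 V → ℝ) (hw : ∀ e ∈ G.edgeSet, 0 < w e)
    (p : ℕ) (hp : 2 ≤ p) (T : Fin p → Set V)
    (C : Finset (Sym2 V)) (hC : IsOptimalMultiClusterCut G w T C)
    (hcomp : ∀ i : Fin p, InducesOneComponent G C (T i)) :
    ({f : R.Face | IsJointVertex R (C : Set (Sym2 V)) f}.ncard : ℤ) ≤ 2 * (p : ℤ) - 4 := by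
  have := Fintype.ofFinite V
  choose c hc huniq using hcomp
  have hT : ∀ i, (T i).Nonempty := fun i => (hc i).imp fun _ h => h.1
  have hsep : ∀ d : G.Dart, d.edge ∈ C →
      ¬ (G.deleteEdges (C : Set (Sym2 V))).Reachable d.fst d.snd := by
    intro d hd hreach
    obtain ⟨i, j, hij, s, hs, t, ht, hst⟩ := hC.exists_terminals hw
      (q := (G.deleteEdges (C : Set (Sym2 V))).connectedComponentMk)
      (fun _ _ h => SimpleGraph.ConnectedComponent.connectedComponentMk_eq_of_adj h)
      (u := d.fst) (v := d.snd) hd (SimpleGraph.ConnectedComponent.sound hreach)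
    exact hC.1.2 i j hij s hs t ht (SimpleGraph.ConnectedComponent.exact hst)
  have hne : C.Nonempty := by
    rw [Finset.nonempty_iff_ne_empty]
    rintro rfl
    obtain ⟨s, hs⟩ := hT ⟨0, by omega⟩
    obtain ⟨t, ht⟩ := hT ⟨1, by omega⟩
    refine hC.1.2 ⟨0, by omega⟩ ⟨1, by omega⟩ (by simp) s hs t ht ?_
    simpa using hG.preconnected s t
  -- A component containing a terminal of cluster i is the only component of that cluster, so there
  -- are at most p components.
  have hsurj : Function.Surjective c := by
    intro k
    obtain ⟨i, t, ht, htk⟩ := hC.exists_mem_supp hG hw ⟨⟨0, by omega⟩, hT _⟩ k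
    exact ⟨i, (huniq i k ⟨t, ht, htk⟩).symm⟩
  have hcard := Nat.card_le_card_of_surjective c hsurj
  rw [Nat.card_eq_fintype_card (α := Fin p), Fintype.card_fin] at hcard
  have := R.ncard_jointVertex_add_four_le hG hR C hC.1.1 hne hsep
  omega
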